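/- Let $(\Omega,\mathcal F,P)$ be a probability space carrying a real Brownian motion $W$, let $(\mathcal F_s)_{s\ge 0}$ be the filtration generated by $W$ (augmented by the $P$-null events), and let $0\le t\le T$, $x\in\mathbb R$, $k\in\mathbb N$. Let $\mathcal D[t,T]$ be the set of deterministic piecewise continuous functions $[t,T]\to\mathbb R$ (continuous off a finite set, with finite one-sided limits everywhere), and let $\mathcal U[t,T]$ be the set of all progressively measurable $\mathbb R^k$-valued processes $u$ on $[t,T]$ with $\mathbb E\int_t^T|u_s|^2\,ds<\infty$. Let $\beta\in\mathcal D[t,T]$. Let $b,\sigma:\mathbb R\times\mathbb R\times\mathbb R^k\to\mathbb R$ be continuous functions $(\beta,x,u)\mapsto b(\beta,x,u),\sigma(\beta,x,u)$ that are Lipschitz continuous and of linear growth in $(x,u)$, uniformly for $\beta$ in bounded sets, and let $f:\mathbb R\times\mathbb R^k\to\mathbb R$ and $\Phi:\mathbb R\to\mathbb R$ be continuous and of polynomial growth. For $u\in\mathcal U[t,T]$ let $X^u$ be the (square integrable, unique) solution of $$dX^u_s=b(\beta_s,X^u_s,u_s)\,ds+\sigma(\beta_s,X^u_s,u_s)\,dW_s,\qquad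 X^u_t=x,$$ and let $$J(t,x;u)=\mathbb E\Big[\int_t^T f(X^u_s,u_s)\,ds+\Phi(X^u_T)\Big]\in[-\infty,\infty],$$ where an integral whose positive part is infinite is given the value $+\infty$. Let $u^*:\mathbb R\times[t,T]\times\mathbb R\to\mathbb R^k$ be a measurable function that, uniformly for $s\in[t,T]$ and $r$ in bounded sets, is Lipschitz continuous in the last variable and bounded at $(r,s,0)$. Suppose that $u^*$ is a feedback optimal control for the parameter $\beta$: the state equation closed with $u_s=u^*(\beta_s,s,X_s)$ has a solution $X^*$, and the control $s\mapsto u^*(\beta_s,s,X^*_s)$ belongs to $\mathcal U[t,T]$ and minimizes $J(t,x;\cdot)$ over $\mathcal U[t,T]$. For $\rho\in\mathcal D[t,T]$ put $u^\rho_s=u^*(\rho_s,s,X^\rho_s)$, where $X^\rho$ is the solution of $$dX^\rho_s=b(\beta_s,X^\rho_s,u^*(\rho_s,s,X^\rho_s))\,ds+\sigma(\beta_s,X^\rho_s,u^*(\rho_s,s,X^\rho_s))\,dW_s,\qquad X^\rho_t=x,$$ and let $$\hat J(t,x;\rho)=\mathbb E\Big[\int_t^T f(X^\rho_s,u^\rho_s)\,ds+\Phi(X^\rho_T)\Big].$$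 Then $$\inf_{\rho\in\mathcal D[t,T]}\hat J(t,x;\rho)=\inf_{u\in\mathcal U[t,T]}J(t,x;u).$$ -/

import Mathlib

open MeasureTheory ProbabilityTheory Filter Topology
open scoped NNReal ENNReal

noncomputable section

namespace FeedbackControl

/-- The Euclidean space in which controls take their values. -/
abbrev Euc (k : ℕ) : Type := EuclideanSpace ℝ (Fin k)

/-- The filtration generated by the process `W`, augmented by the `P`-null events. -/
def brownianFiltration {Ω : Type*} [m : MeasurableSpace Ω] (P : Measure Ω)
    (W : ℝ≥0 → Ω → ℝ) (hW : ∀ s, Measurable (W s)) : Filtration ℝ≥0 m where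
  seq s := (⨆ r ≤ s, MeasurableSpace.comap (W r) inferInstance) ⊔
    MeasurableSpace.generateFrom {A : Set Ω | MeasurableSet A ∧ P A = 0}
  mono' _ _ hsr := sup_le_sup_right (biSup_mono fun _ h => le_trans h hsr) _
  le' s := by
    refine sup_le (iSup₂_le fun r _ => (hW r).comap_le) ?_
    exact MeasurableSpace.generateFrom_le fun A hA => hA.1

/-- Progressive measurability on the time interval `[t, T]`. -/
def ProgressiveOn {Ω E : Type*} [m : MeasurableSpace Ω] [TopologicalSpace E]
    (F : Filtration ℝ≥0 m) (t T : ℝ≥0) (u : ℝ≥0 → Ω → E) : Prop :=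
  ∀ s ∈ Set.Icc t T, StronglyMeasurable[Subtype.instMeasurableSpace.prod (F s)]
    fun p : Set.Icc t s × Ω => u p.1 p.2

/-- Lebesgue measure on the time axis `[0, ∞)`. -/
def leb : Measure ℝ≥0 := Measure.comap ((↑) : ℝ≥0 → ℝ) volume

/-- `E ∫_t^T |u_s|² ds`. -/
def l2Energy {Ω E : Type*} [MeasurableSpace Ω] [NormedAddCommGroup E] (P : Measure Ω)
    (t T : ℝ≥0) (u : ℝ≥0 → Ω → E) : ℝ≥0∞ :=
  ∫⁻ ω, (∫⁻ s in Set.Icc t T, ‖u s ω‖ₑ ^ 2 ∂leb) ∂P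

/-- The admissible controls: progressively measurable, square integrable processes
on `[t, T]`. -/
def Admissible {Ω : Type*} [m : MeasurableSpace Ω] {k : ℕ} (P : Measure Ω)
    (F : Filtration ℝ≥0 m) (t T : ℝ≥0) : Set (ℝ≥0 → Ω → Euc k) :=
  {u | ProgressiveOn F t T u ∧ l2Energy P t T u < ∞}

/-- The (deterministic) piecewise continuous functions on `[t, T]`: continuous off a finite set,
with finite one-sided limits at every point. -/
def PiecewiseCont (t T : ℝ≥0) : Set (ℝ≥0 → ℝ) :=
  {ρ | (∃ S : Finset ℝ≥0, ∀ s ∈ Set.Icc t T, s ∉ S → ContinuousWithinAt ρ (Set.Icc t T) s) ∧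
    ∀ s ∈ Set.Icc t T, (∃ l, Tendsto ρ (𝓝[Set.Ioo t s] s) (𝓝 l)) ∧
      ∃ l, Tendsto ρ (𝓝[Set.Ioo s T] s) (𝓝 l)}

/-- A simple process `∑ i < n, ξ i · 1_{(τ i, τ (i+1)]}` on `[t, T]`, with `ξ i` bounded and
measurable with respect to `F (τ i)`. -/
structure SimpleProcess {Ω : Type*} [m : MeasurableSpace Ω] (F : Filtration ℝ≥0 m)
    (t T : ℝ≥0) where
  n : ℕ
  τ : ℕ → ℝ≥0
  ξ : ℕ → Ω → ℝ
  mono : Monotone τ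
  mem : ∀ i, τ i ∈ Set.Icc t T
  meas : ∀ i, Measurable[F (τ i)] (ξ i)
  bdd : ∀ i, ∃ C, ∀ ω, |ξ i ω| ≤ C

/-- The value of a simple process. -/
def SimpleProcess.val {Ω : Type*} [m : MeasurableSpace Ω] {F : Filtration ℝ≥0 m} {t T : ℝ≥0}
    (H : SimpleProcess F t T) (s : ℝ≥0) (ω : Ω) : ℝ :=
  ∑ i ∈ Finset.range H.n, (Set.Ioc (H.τ i) (H.τ (i + 1))).indicator (fun _ => H.ξ i ω) s

/-- The elementary stochastic integral `∫_t^s H dW` of a simple process. -/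
def SimpleProcess.integral {Ω : Type*} [m : MeasurableSpace Ω] {F : Filtration ℝ≥0 m}
    {t T : ℝ≥0} (H : SimpleProcess F t T) (W : ℝ≥0 → Ω → ℝ) (s : ℝ≥0) (ω : Ω) : ℝ :=
  ∑ i ∈ Finset.range H.n, H.ξ i ω * (W (min (H.τ (i + 1)) s) ω - W (min (H.τ i) s) ω)

/-- `I s` is (a version of) the Itô integral `∫_t^s H dW` for every `s ∈ [t, T]`: `H` is
progressively measurable, and `I` is the `L²`-limit of the elementary integrals of simple
processes that approximate `H` in `L²(dP ⊗ ds)`. -/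
def IsItoIntegral {Ω : Type*} [m : MeasurableSpace Ω] (P : Measure Ω) (F : Filtration ℝ≥0 m)
    (W : ℝ≥0 → Ω → ℝ) (t T : ℝ≥0) (H I : ℝ≥0 → Ω → ℝ) : Prop :=
  ProgressiveOn F t T H ∧ ∃ A : ℕ → SimpleProcess F t T,
    Tendsto (fun n => l2Energy P t T fun s ω => (A n).val s ω - H s ω) atTop (𝓝 0) ∧
    ∀ s ∈ Set.Icc t T,
      Tendsto (fun n => ∫⁻ ω, ‖(A n).integral W s ω - I s ω‖ₑ ^ 2 ∂P) atTop (𝓝 0)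

/-- `X` is a strong solution on `[t, T]` of the Itô equation
`dX_s = B(s, X_s) ds + S(s, X_s) dW_s`, `X_t = x`, with random coefficients `B` and `S`:
a progressively measurable, square integrable process with almost surely continuous paths that
satisfies the integrated equation at all times, almost surely. -/
structure IsSolution {Ω : Type*} [m : MeasurableSpace Ω] (P : Measure Ω)
    (F : Filtration ℝ≥0 m) (W : ℝ≥0 → Ω → ℝ) (t T : ℝ≥0) (x : ℝ)
    (B S : ℝ≥0 → ℝ → Ω → ℝ) (X : ℝ≥0 → Ω → ℝ) : Prop where
  progressive : ProgressiveOn F t T X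
  continuous : ∀ᵐ ω ∂P, ContinuousOn (fun s => X s ω) (Set.Icc t T)
  sq_integrable : l2Energy P t T X < ∞
  drift_integrable : ∀ᵐ ω ∂P, IntegrableOn (fun s => B s (X s ω) ω) (Set.Icc t T) leb
  equation : ∃ I, IsItoIntegral P F W t T (fun s ω => S s (X s ω) ω) I ∧
    ∀ᵐ ω ∂P, ∀ s ∈ Set.Icc t T,
      X s ω = x + (∫ r in Set.Icc t s, B r (X r ω) ω ∂leb) + I s ω

/-- `X` is the state `X^u` of the control `u`:
`dX_s = b(β_s, X_s, u_s) ds + σ(β_s, X_s, u_s) dW_s`, `X_t = x`. -/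
def IsState {Ω : Type*} [m : MeasurableSpace Ω] {k : ℕ} (P : Measure Ω)
    (F : Filtration ℝ≥0 m) (W : ℝ≥0 → Ω → ℝ) (t T : ℝ≥0) (x : ℝ)
    (b σ : ℝ → ℝ → Euc k → ℝ) (β : ℝ≥0 → ℝ) (u : ℝ≥0 → Ω → Euc k) (X : ℝ≥0 → Ω → ℝ) : Prop :=
  IsSolution P F W t T x (fun s y ω => b (β s) y (u s ω)) (fun s y ω => σ (β s) y (u s ω)) X

/-- `X` is the state `X^ρ` obtained by using the feedback law `φ` with the parameter replaced by
`ρ`: `dX_s = b(β_s, X_s, φ(ρ_s, s, X_s)) ds + σ(β_s, X_s, φ(ρ_s, s, X_s)) dW_s`, `X_t = x`. -/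
def IsFeedbackState {Ω : Type*} [m : MeasurableSpace Ω] {k : ℕ} (P : Measure Ω)
    (F : Filtration ℝ≥0 m) (W : ℝ≥0 → Ω → ℝ) (t T : ℝ≥0) (x : ℝ)
    (b σ : ℝ → ℝ → Euc k → ℝ) (β : ℝ≥0 → ℝ) (φ : ℝ → ℝ≥0 → ℝ → Euc k) (ρ : ℝ≥0 → ℝ)
    (X : ℝ≥0 → Ω → ℝ) : Prop :=
  IsSolution P F W t T x (fun s y _ => b (β s) y (φ (ρ s) s y))
    (fun s y _ => σ (β s) y (φ (ρ s) s y)) X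

/-- The control process `u_s = φ(ρ_s, s, X_s)`. -/
def feedbackControl {Ω : Type*} {k : ℕ} (φ : ℝ → ℝ≥0 → ℝ → Euc k) (ρ : ℝ≥0 → ℝ)
    (X : ℝ≥0 → Ω → ℝ) : ℝ≥0 → Ω → Euc k :=
  fun s ω => φ (ρ s) s (X s ω)

/-- The integral of an extended real function, with values in `[-∞, ∞]`. It is the usual one
(positive part minus negative part) whenever one of the two parts has a finite integral; if both
are infinite, so that the integral is undefined, the value is `∞`. -/
def extIntegral {α : Type*} [MeasurableSpace α] (μ : Measure α) (g : α → EReal) : EReal :=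
  open Classical in
  if ∫⁻ a, (g a).toENNReal ∂μ = ∞ then ⊤
  else ((∫⁻ a, (g a).toENNReal ∂μ : ℝ≥0∞) : EReal) - ((∫⁻ a, (-g a).toENNReal ∂μ : ℝ≥0∞) : EReal)

/-- The cost `E[∫_t^T f(X_s, u_s) ds + Φ(X_T)]` of a state-control pair. -/
def pairCost {Ω : Type*} [MeasurableSpace Ω] {k : ℕ} (P : Measure Ω) (t T : ℝ≥0)
    (f : ℝ → Euc k → ℝ) (Φ : ℝ → ℝ) (X : ℝ≥0 → Ω → ℝ) (u : ℝ≥0 → Ω → Euc k) : EReal :=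
  extIntegral P fun ω =>
    extIntegral (leb.restrict (Set.Icc t T)) (fun s => ((f (X s ω) (u s ω) : ℝ) : EReal)) +
      ((Φ (X T ω) : ℝ) : EReal)

/-- The cost functional `J(t, x; u)`: the cost of `u` together with its state `X^u`. (For Lipschitz
coefficients of linear growth the state is unique up to indistinguishability, so that the infimum
over states is just its value at that state.) -/
def J {Ω : Type*} [m : MeasurableSpace Ω] {k : ℕ} (P : Measure Ω)
    (F : Filtration ℝ≥0 m) (W : ℝ≥0 → Ω → ℝ) (t T : ℝ≥0) (x : ℝ)
    (b σ : ℝ → ℝ → Euc k → ℝ) (f : ℝ → Euc k → ℝ) (Φ : ℝ → ℝ) (β : ℝ≥0 → ℝ)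
    (u : ℝ≥0 → Ω → Euc k) : EReal :=
  ⨅ (X : ℝ≥0 → Ω → ℝ) (_ : IsState P F W t T x b σ β u X), pairCost P t T f Φ X u

/-- The cost functional `Ĵ(t, x; ρ) = E[∫_t^T f(X^ρ_s, φ(ρ_s, s, X^ρ_s)) ds + Φ(X^ρ_T)]`, with
the (unique) state `X^ρ`. -/
def Jhat {Ω : Type*} [m : MeasurableSpace Ω] {k : ℕ} (P : Measure Ω)
    (F : Filtration ℝ≥0 m) (W : ℝ≥0 → Ω → ℝ) (t T : ℝ≥0) (x : ℝ)
    (b σ : ℝ → ℝ → Euc k → ℝ) (f : ℝ → Euc k → ℝ) (Φ : ℝ → ℝ) (β : ℝ≥0 → ℝ)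
    (φ : ℝ → ℝ≥0 → ℝ → Euc k) (ρ : ℝ≥0 → ℝ) : EReal :=
  ⨅ (X : ℝ≥0 → Ω → ℝ) (_ : IsFeedbackState P F W t T x b σ β φ ρ X),
    pairCost P t T f Φ X (feedbackControl φ ρ X)

/-- `φ` is a feedback optimal control for the parameter `β`: the equation closed with
`u_s = φ(β_s, s, X_s)` has a solution `X*`, and the resulting control `u*_s = φ(β_s, s, X*_s)` is
admissible and has, with its state `X*`, the least cost among all admissible controls. -/
def IsOptimalFeedback {Ω : Type*} [m : MeasurableSpace Ω] {k : ℕ} (P : Measure Ω)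
    (F : Filtration ℝ≥0 m) (W : ℝ≥0 → Ω → ℝ) (t T : ℝ≥0) (x : ℝ)
    (b σ : ℝ → ℝ → Euc k → ℝ) (f : ℝ → Euc k → ℝ) (Φ : ℝ → ℝ) (β : ℝ≥0 → ℝ)
    (φ : ℝ → ℝ≥0 → ℝ → Euc k) : Prop :=
  ∃ X : ℝ≥0 → Ω → ℝ, IsFeedbackState P F W t T x b σ β φ β X ∧
    feedbackControl φ β X ∈ Admissible P F t T ∧
    ∀ u ∈ Admissible P F t T,
      pairCost P t T f Φ X (feedbackControl φ β X) ≤ J P F W t T x b σ f Φ β u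

/-- A coefficient `g(β, x, u)` of the state equation: continuous, and, uniformly for `β` in bounded
sets, Lipschitz continuous and of linear growth in `(x, u)`. -/
structure IsCoefficient {k : ℕ} (g : ℝ → ℝ → Euc k → ℝ) : Prop where
  continuous : Continuous fun p : ℝ × ℝ × Euc k => g p.1 p.2.1 p.2.2
  lipschitz : ∀ R : ℝ, ∃ L : ℝ, ∀ r : ℝ, |r| ≤ R → ∀ (y y' : ℝ) (v v' : Euc k),
    |g r y v - g r y' v'| ≤ L * (|y - y'| + ‖v - v'‖)
  growth : ∀ R : ℝ, ∃ L : ℝ, ∀ r : ℝ, |r| ≤ R → ∀ (y : ℝ) (v : Euc k),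
    |g r y v| ≤ L * (1 + |y| + ‖v‖)

/-- A feedback law `φ(β, s, x)`: measurable, Lipschitz continuous in `x`, uniformly for `s ∈ [t, T]`
and `β` in bounded sets, and bounded at `x = 0` for such `s` and `β`. -/
structure IsLipschitzFeedback {k : ℕ} (t T : ℝ≥0) (φ : ℝ → ℝ≥0 → ℝ → Euc k) : Prop where
  measurable : Measurable fun p : ℝ × ℝ≥0 × ℝ => φ p.1 p.2.1 p.2.2
  lipschitz : ∀ R : ℝ, ∃ L : ℝ, ∀ r : ℝ, |r| ≤ R → ∀ s ∈ Set.Icc t T, ∀ y y' : ℝ,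
    ‖φ r s y - φ r s y'‖ ≤ L * |y - y'|
  bounded : ∀ R : ℝ, ∃ C : ℝ, ∀ r : ℝ, |r| ≤ R → ∀ s ∈ Set.Icc t T, ‖φ r s 0‖ ≤ C

end FeedbackControl

end

namespace FeedbackControl

/-! The choice `ρ = β` reproduces the optimal control, so the left infimum is at most every `J u`.
Conversely, any solution for any `ρ` is also a state of the open-loop control it generates, with the
same cost, so it cannot beat the right infimum once that control is admissible. Admissibility,
`feedbackControl_mem_admissible`, is the only real work: `ρ` is bounded and measurable on `[t, T]`,
so the control is progressive and grows linearly in the square integrable state. No existence or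
uniqueness for the SDE is needed: without a solution `Jhat` is `⊤`. -/

theorem leb_Icc_lt_top (t T : ℝ≥0) : leb (Set.Icc t T) < ∞ := by
  have he : MeasurableEmbedding ((↑) : ℝ≥0 → ℝ) :=
    MeasurableEmbedding.subtype_coe measurableSet_Ici
  rw [leb, he.comap_apply]
  refine lt_of_le_of_lt (measure_mono (t := Set.Icc (t : ℝ) T) ?_) measure_Icc_lt_top
  rintro _ ⟨s, hs, rfl⟩
  exact ⟨hs.1, hs.2⟩

/-- A piecewise continuous function on `[t, T]` is bounded there. -/
theorem PiecewiseCont.exists_bound {t T : ℝ≥0} {ρ : ℝ≥0 → ℝ} (hρ : ρ ∈ PiecewiseCont t T) :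
    ∃ R : ℝ, ∀ s ∈ Set.Icc t T, |ρ s| ≤ R := by
  have near : ∀ {A : Set ℝ≥0} {s : ℝ≥0}, (∃ l, Tendsto ρ (𝓝[A] s) (𝓝 l)) →
      ∃ C : ℝ, ∀ᶠ r in 𝓝 s, r ∈ A → |ρ r| ≤ C := by
    rintro A s ⟨l, hl⟩
    exact ⟨|l| + 1, eventually_nhdsWithin_iff.1
      ((hl.abs.eventually_lt_const (lt_add_one _)).mono fun _ h => h.le)⟩
  refine isCompact_Icc.induction_on (p := fun A => ∃ R : ℝ, ∀ s ∈ A, |ρ s| ≤ R)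
    ⟨0, by simp⟩ ?_ ?_ ?_
  · rintro A B hAB ⟨R, hR⟩
    exact ⟨R, fun s hs => hR s (hAB hs)⟩
  · rintro A B ⟨R, hR⟩ ⟨R', hR'⟩
    refine ⟨max R R', fun s hs => ?_⟩
    rcases hs with hs | hs
    · exact (hR s hs).trans (le_max_left _ _)
    · exact (hR' s hs).trans (le_max_right _ _)
  · intro s hs
    obtain ⟨C, hC⟩ := near (hρ.2 s hs).1
    obtain ⟨C', hC'⟩ := near (hρ.2 s hs).2
    -- The one-sided limits are taken along open intervals and say nothing about `s`, `t` and `T`,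
    -- whose values enter the bound separately.
    refine ⟨_, inter_mem_nhdsWithin _ (hC.and hC'),
      max (max C C') (max |ρ s| (max |ρ t| |ρ T|)), ?_⟩
    rintro r ⟨hr, h, h'⟩
    rcases lt_trichotomy r s with hrs | rfl | hrs
    · rcases hr.1.eq_or_lt with rfl | htr
      · simp
      · simp [h ⟨htr, hrs⟩]
    · simp
    · rcases hr.2.eq_or_lt with rfl | hrT
      · simp
      · simp [h' ⟨hrs, hrT⟩]

/-- A piecewise continuous function on `[t, T]`, extended by zero, is Borel measurable. -/
theorem PiecewiseCont.measurable_indicator {t T : ℝ≥0} {ρ : ℝ≥0 → ℝ}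
    (hρ : ρ ∈ PiecewiseCont t T) : Measurable ((Set.Icc t T).indicator ρ) := by
  obtain ⟨S, hS⟩ := hρ.1
  have hcont : ContinuousOn ρ (Set.Icc t T \ S) := fun s hs =>
    (hS s hs.1 hs.2).mono Set.sdiff_subset
  have hmeas : Measurable ((Set.Icc t T \ S).indicator ρ) := by
    classical
    rw [← Set.piecewise_eq_indicator]
    exact hcont.measurable_piecewise continuousOn_const
      (measurableSet_Icc.diff S.finite_toSet.measurableSet)
  -- The two indicators differ only on the finite set `S`.
  refine hmeas.measurable_of_countable_ne (S.finite_toSet.countable.mono fun s hs => ?_)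
  by_contra hsS
  refine hs ?_
  by_cases h : s ∈ Set.Icc t T
  · rw [Set.indicator_of_mem h, Set.indicator_of_mem (show s ∈ Set.Icc t T \ S from ⟨h, hsS⟩)]
  · rw [Set.indicator_of_notMem h, Set.indicator_of_notMem fun h' => h h'.1]

theorem ProgressiveOn.feedbackControl {Ω : Type*} [MeasurableSpace Ω] {k : ℕ}
    {F : Filtration ℝ≥0 ‹MeasurableSpace Ω›} {t T : ℝ≥0} {φ : ℝ → ℝ≥0 → ℝ → Euc k}
    (hφ : Measurable fun p : ℝ × ℝ≥0 × ℝ => φ p.1 p.2.1 p.2.2) {ρ : ℝ≥0 → ℝ}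
    (hρ : ρ ∈ PiecewiseCont t T) {X : ℝ≥0 → Ω → ℝ} (hX : ProgressiveOn F t T X) :
    ProgressiveOn F t T (feedbackControl φ ρ X) := by
  intro s hs
  let _ : MeasurableSpace Ω := F s
  have htime : Measurable fun p : Set.Icc t s × Ω => (p.1 : ℝ≥0) :=
    measurable_subtype_coe.comp measurable_fst
  -- Nothing is known about `ρ` off `[t, T]`, so its extension by zero is composed instead; both
  -- agree at the times that occur.
  have h := hφ.comp (((PiecewiseCont.measurable_indicator hρ).comp htime).prodMk
    (htime.prodMk (hX s hs).measurable))
  refine (show Measurable _ from ?_).stronglyMeasurable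
  refine (congrArg Measurable (funext fun p => ?_)).mpr h
  have hp : (p.1 : ℝ≥0) ∈ Set.Icc t T := ⟨p.1.2.1, p.1.2.2.trans hs.2⟩
  simp only [Function.comp_apply, Set.indicator_of_mem hp]
  rfl

theorem l2Energy_lt_top_of_linear_growth {Ω E : Type*} [MeasurableSpace Ω]
    [NormedAddCommGroup E] {P : Measure Ω} [IsFiniteMeasure P] {t T : ℝ≥0}
    {X : ℝ≥0 → Ω → ℝ} {u : ℝ≥0 → Ω → E} {C L : ℝ≥0}
    (hu : ∀ s ∈ Set.Icc t T, ∀ ω, ‖u s ω‖ₑ ≤ C + L * ‖X s ω‖ₑ)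
    (hX : l2Energy P t T X < ∞) : l2Energy P t T u < ∞ := by
  have hsq : ∀ s ∈ Set.Icc t T, ∀ ω,
      ‖u s ω‖ₑ ^ 2 ≤ 2 * (C : ℝ≥0∞) ^ 2 + 2 * (L : ℝ≥0∞) ^ 2 * ‖X s ω‖ₑ ^ 2 := by
    intro s hs ω
    have h : (C + L * ‖X s ω‖₊) ^ 2 ≤ 2 * C ^ 2 + 2 * L ^ 2 * ‖X s ω‖₊ ^ 2 := by
      rw [← NNReal.coe_le_coe]
      push_cast
      -- `2a² + 2b² - (a + b)² = (a - b)²`.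
      nlinarith [sq_nonneg ((C : ℝ) - L * ‖X s ω‖)]
    calc ‖u s ω‖ₑ ^ 2 ≤ (C + L * ‖X s ω‖ₑ) ^ 2 := by gcongr; exact hu s hs ω
      _ ≤ _ := by simp only [enorm_eq_nnnorm]; exact_mod_cast h
  calc l2Energy P t T u
      ≤ ∫⁻ ω, (∫⁻ s in Set.Icc t T,
          (2 * (C : ℝ≥0∞) ^ 2 + 2 * (L : ℝ≥0∞) ^ 2 * ‖X s ω‖ₑ ^ 2) ∂leb) ∂P :=
        lintegral_mono fun ω => setLIntegral_mono' measurableSet_Icc fun s hs => hsq s hs ω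
    _ = 2 * (C : ℝ≥0∞) ^ 2 * leb (Set.Icc t T) * P Set.univ
          + 2 * (L : ℝ≥0∞) ^ 2 * l2Energy P t T X := by
        -- A finite constant leaves both integrals without any measurability of `X`.
        have hL : 2 * (L : ℝ≥0∞) ^ 2 ≠ ∞ := by finiteness
        simp_rw [lintegral_add_left measurable_const, lintegral_const_mul' _ _ hL,
          lintegral_const, Measure.restrict_apply_univ]
        rfl
    _ < ∞ := by
        have := leb_Icc_lt_top t T
        finiteness

/-- The control produced by a Lipschitz feedback law with a piecewise continuous parameter is
admissible. -/
theorem feedbackControl_mem_admissible {Ω : Type*} [MeasurableSpace Ω] {k : ℕ}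
    {P : Measure Ω} [IsFiniteMeasure P] {F : Filtration ℝ≥0 ‹MeasurableSpace Ω›} {t T : ℝ≥0}
    {φ : ℝ → ℝ≥0 → ℝ → Euc k} (hφ : IsLipschitzFeedback t T φ) {ρ : ℝ≥0 → ℝ}
    (hρ : ρ ∈ PiecewiseCont t T) {X : ℝ≥0 → Ω → ℝ} (hX : ProgressiveOn F t T X)
    (hX2 : l2Energy P t T X < ∞) : feedbackControl φ ρ X ∈ Admissible P F t T := by
  refine ⟨hX.feedbackControl hφ.measurable hρ, ?_⟩
  obtain ⟨R, hR⟩ := PiecewiseCont.exists_bound hρ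
  obtain ⟨L, hL⟩ := hφ.lipschitz R
  obtain ⟨C, hC⟩ := hφ.bounded R
  refine l2Energy_lt_top_of_linear_growth (C := C.toNNReal) (L := L.toNNReal) ?_ hX2
  intro s hs ω
  have h : ‖φ (ρ s) s (X s ω)‖₊ ≤ C.toNNReal + L.toNNReal * ‖X s ω‖₊ := by
    rw [← NNReal.coe_le_coe]
    push_cast
    calc ‖φ (ρ s) s (X s ω)‖ ≤ ‖φ (ρ s) s 0‖ + ‖φ (ρ s) s (X s ω) - φ (ρ s) s 0‖ :=
          norm_le_norm_add_norm_sub' _ _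
      _ ≤ C + L * ‖X s ω‖ := by
          refine add_le_add (hC _ (hR s hs) s hs) ?_
          simpa using hL _ (hR s hs) s hs (X s ω) 0
      -- `C` and `L` carry no sign; truncation at zero only enlarges them.
      _ ≤ _ := by gcongr <;> exact Real.le_coe_toNNReal _
  simp only [FeedbackControl.feedbackControl, enorm_eq_nnnorm]
  exact_mod_cast h

end FeedbackControl

theorem theorem2 {Ω : Type*} [MeasurableSpace Ω] (P : Measure Ω) [IsProbabilityMeasure P]
    (W : ℝ≥0 → Ω → ℝ) (hWm : ∀ s, Measurable (W s)) (hW : IsBrownianReal W P)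
    {k : ℕ} (t T : ℝ≥0) (htT : t ≤ T) (x : ℝ)
    (b σ : ℝ → ℝ → FeedbackControl.Euc k → ℝ)
    (f : ℝ → FeedbackControl.Euc k → ℝ) (Φ : ℝ → ℝ)
    (hb : FeedbackControl.IsCoefficient b) (hσ : FeedbackControl.IsCoefficient σ)
    (hf : Continuous fun p : ℝ × FeedbackControl.Euc k => f p.1 p.2) (hΦ : Continuous Φ)
    (hfg : ∃ (C : ℝ) (q : ℕ), ∀ y v, |f y v| ≤ C * (1 + |y| ^ q + ‖v‖ ^ q))
    (hΦg : ∃ (C : ℝ) (q : ℕ), ∀ y, |Φ y| ≤ C * (1 + |y| ^ q))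
    (β : ℝ≥0 → ℝ) (hβ : β ∈ FeedbackControl.PiecewiseCont t T)
    (φ : ℝ → ℝ≥0 → ℝ → FeedbackControl.Euc k)
    (hφ : FeedbackControl.IsLipschitzFeedback t T φ)
    (hopt : FeedbackControl.IsOptimalFeedback P (FeedbackControl.brownianFiltration P W hWm) W
      t T x b σ f Φ β φ) :
    (⨅ ρ ∈ FeedbackControl.PiecewiseCont t T,
      FeedbackControl.Jhat P (FeedbackControl.brownianFiltration P W hWm) W
        t T x b σ f Φ β φ ρ) =
    ⨅ u ∈ FeedbackControl.Admissible P (FeedbackControl.brownianFiltration P W hWm) t T,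
      FeedbackControl.J P (FeedbackControl.brownianFiltration P W hWm) W
        t T x b σ f Φ β u := by
  apply le_antisymm
  · obtain ⟨X, hX, -, hmin⟩ := hopt
    exact le_iInf₂ fun u hu => (iInf₂_le β hβ).trans ((iInf₂_le X hX).trans (hmin u hu))
  · refine le_iInf₂ fun ρ hρ => le_iInf₂ fun X hX => ?_
    -- The closed-loop and open-loop coefficients differ as functions of `y`, but `IsSolution`
    -- evaluates them only at `y = X s ω`, where they coincide definitionally.
    have hX' : FeedbackControl.IsState P (FeedbackControl.brownianFiltration P W hWm) W t T x
        b σ β (FeedbackControl.feedbackControl φ ρ X) X :=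
      ⟨hX.progressive, hX.continuous, hX.sq_integrable, hX.drift_integrable, hX.equation⟩
    exact (iInf₂_le (FeedbackControl.feedbackControl φ ρ X)
      (FeedbackControl.feedbackControl_mem_admissible hφ hρ hX.progressive hX.sq_integrable)).trans
      (iInf₂_le X hX')
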